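/- Let $S^3=\{z_1+z_2j : z_1,z_2\in\mathbb C,\ |z_1|^2+|z_2|^2=1\}$, let $T_1=\{z_1+z_2j\in S^3 : |z_1|\le \sqrt2/2\}$, with boundary torus $\partial T_1=\{|z_1|=\sqrt2/2\}$, and let $\mu,\lambda$ be the oriented curves on $\partial T_1$ given for $z\in S^1$ (with its counterclockwise orientation) by $\mu(z)=\frac{\sqrt2}{2}(z+j)$, a meridian of $T_1$, and $\lambda(z)=\frac{\sqrt2}{2}(1+zj)$, a longitude of $T_1$ and a meridian of the complementary solid torus $\{|z_2|\le\sqrt2/2\}$. Let $d,e,g$ be integers with $e\neq0$ and $\gcd(d,e,g)=1$, and let $\rho$ be the isometry of $S^3$ $$\rho(z_1+z_2j)=e^{2\pi i g/e}z_1+e^{2\pi i d/e}z_2j .$$ Then $T_1/\langle\rho\rangle$ is a solid torus, that is, homeomorphic to $D^2\times S^1$, and its boundary is the image of $\partial T_1$ under the quotient map $\pi_1:T_1\to T_1/\langle\rho\rangle$. Put $d'=d/\gcd(d,e)$ and $e'=e/\gcd(d,e)$, and let $\overline{d'}$ be any integer with $d'\,\overline{d'}\equiv1 \pmod{e'}$.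 Then there are oriented simple closed curves $\mu',\lambda'$ on the boundary of $T_1/\langle\rho\rangle$, a meridian and a longitude (the images of $\partial D^2\times\{1\}$ and $\{1\}\times S^1$ under one homeomorphism $D^2\times S^1\to T_1/\langle\rho\rangle$), such that the map $\pi_1^*:H_1(\partial T_1;\mathbb Z)\to H_1(\partial(T_1/\langle\rho\rangle);\mathbb Z)$ induced by $\pi_1$ satisfies $$\pi_1^*([\mu])=\gcd(d,e)\,[\mu'],\qquad \pi_1^*([\lambda])=-(g\,\overline{d'})\,[\mu']+e'\,[\lambda'].$$ -/

import Mathlib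

open CategoryTheory AlgebraicTopology Simplicial

noncomputable section

namespace TorusQuotient

/-! ### First singular homology and the classes of oriented closed curves -/

/-- `H₁(X; ℤ)`, the first singular homology group. -/
abbrev H1 (X : Type) [TopologicalSpace X] : ModuleCat.{0} ℤ :=
  ((singularHomologyFunctor (ModuleCat.{0} ℤ) 1).obj (ModuleCat.of ℤ ℤ)).obj (TopCat.of X)

/-- The homomorphism induced on `H₁( · ; ℤ)` by a continuous map. -/
def H1.map {X Y : Type} [TopologicalSpace X] [TopologicalSpace Y] (f : C(X, Y)) :
    H1 X →ₗ[ℤ] H1 Y :=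
  (((singularHomologyFunctor (ModuleCat.{0} ℤ) 1).obj (ModuleCat.of ℤ ℤ)).map
    (TopCat.ofHom f)).hom

/-- The loop running once counterclockwise around the unit circle,
`(x₀, x₁) ↦ exp (2π i x₁)`, as a map on the standard `1`-simplex. -/
def circleLoop : C(stdSimplex ℝ (Fin 2), Circle) where
  toFun x := Circle.exp (2 * Real.pi * x.1 1)
  continuous_toFun := Circle.exp.continuous.comp
    (continuous_const.mul ((continuous_apply 1).comp continuous_subtype_val))

/-- The loop `circleLoop` as a singular `1`-simplex. -/
def circleSimplex : (TopCat.toSSet.obj (TopCat.of Circle)) _⦋1⦌ :=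
  (TopCat.toSSetObjEquiv (TopCat.of Circle) (Opposite.op ⦋1⦌)).symm circleLoop

/-- The two end points of the loop agree. -/
theorem circleSimplex_faces :
    (TopCat.toSSet.obj (TopCat.of Circle)).δ 0 circleSimplex =
      (TopCat.toSSet.obj (TopCat.of Circle)).δ 1 circleSimplex := by
  apply TopCat.toSSetObj₀Equiv.injective
  change circleLoop (stdSimplex.map (Fin.succAbove 0) (default : stdSimplex ℝ (Fin 1))) =
    circleLoop (stdSimplex.map (Fin.succAbove 1) (default : stdSimplex ℝ (Fin 1)))
  rw [Subsingleton.elim (default : stdSimplex ℝ (Fin 1)) (stdSimplex.vertex 0),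
    stdSimplex.map_vertex, stdSimplex.map_vertex]
  simp [circleLoop]

/-- The loop is a singular cycle. -/
theorem circleSimplex_cycle :
    (TopCat.toSSet.obj (TopCat.of Circle)).ιChainComplex (R := ModuleCat.of ℤ ℤ) circleSimplex ≫
      (((singularChainComplexFunctor (ModuleCat.{0} ℤ)).obj (ModuleCat.of ℤ ℤ)).obj
        (TopCat.of Circle)).d 1 0 = 0 := by
  have h := SSet.ιChainComplex_d (TopCat.toSSet.obj (TopCat.of Circle)) (ModuleCat.of ℤ ℤ)
    circleSimplex
  refine h.trans ?_
  rw [Fin.sum_univ_two, circleSimplex_faces]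
  simp
  rfl

/-- The fundamental class of the counterclockwise oriented circle: the homology class of the
singular cycle `circleSimplex`. -/
def circleClass : H1 Circle :=
  (HomologicalComplex.liftCycles
      (((singularChainComplexFunctor (ModuleCat.{0} ℤ)).obj (ModuleCat.of ℤ ℤ)).obj
        (TopCat.of Circle))
      ((TopCat.toSSet.obj (TopCat.of Circle)).ιChainComplex (R := ModuleCat.of ℤ ℤ) circleSimplex)
      0 (by simp) circleSimplex_cycle ≫
    HomologicalComplex.homologyπ
      (((singularChainComplexFunctor (ModuleCat.{0} ℤ)).obj (ModuleCat.of ℤ ℤ)).obj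
        (TopCat.of Circle)) 1).hom (1 : ℤ)

/-- The class `[γ] ∈ H₁(X; ℤ)` of an oriented closed curve `γ : S¹ → X`. -/
def curveClass {X : Type} [TopologicalSpace X] (γ : C(Circle, X)) : H1 X :=
  H1.map γ circleClass

/-! ### Solid tori, meridians and longitudes -/

/-- The standard solid torus `D² × S¹`. -/
abbrev StdSolidTorus : Type := Metric.closedBall (0 : ℂ) 1 × Circle

/-- The boundary torus `∂D² × S¹` of the standard solid torus. -/
def stdBoundary : Set StdSolidTorus := {p | ‖(p.1 : ℂ)‖ = 1}

/-- A point of the unit circle, as a point of the closed unit disk. -/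
def rim (z : Circle) : Metric.closedBall (0 : ℂ) 1 := ⟨z, by simp [Circle.norm_coe]⟩

/-- A framing of `V` with boundary `B`: a homeomorphism `D² × S¹ ≃ V` carrying `∂D² × S¹`
onto `B`. -/
def IsFraming {V : Type} [TopologicalSpace V] (B : Set V) (h : StdSolidTorus ≃ₜ V) : Prop :=
  h '' stdBoundary = B

/-- The space `V` is a solid torus with boundary `B`. -/
def IsSolidTorus (V : Type) [TopologicalSpace V] (B : Set V) : Prop :=
  ∃ h : StdSolidTorus ≃ₜ V, IsFraming B h

/-- The oriented curves `m` and `l` on the boundary `B` of the solid torus `V` are a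
meridian and a longitude: for some framing, `m` is the image of `∂D² × {1}` and `l` is the image
of `{1} × S¹`. -/
def IsMeridianLongitudePair {V : Type} [TopologicalSpace V] (B : Set V) (m l : C(Circle, B)) :
    Prop :=
  ∃ h : StdSolidTorus ≃ₜ V, IsFraming B h ∧
    (∀ z : Circle, (m z : V) = h (rim z, 1)) ∧ ∀ z : Circle, (l z : V) = h (rim 1, z)

/-! ### The three-sphere, the solid torus `T₁` and the rotations -/

/-- The unit sphere `S³ = {z₁ + z₂ j : |z₁|² + |z₂|² = 1}` of `ℂ²`, where `x.1.fst` is `z₁` and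
`x.1.snd` is `z₂`. -/
abbrev S3 : Type := Metric.sphere (0 : WithLp 2 (ℂ × ℂ)) 1

theorem mem_S3_iff (a b : ℂ) :
    WithLp.toLp 2 (a, b) ∈ Metric.sphere (0 : WithLp 2 (ℂ × ℂ)) 1 ↔ ‖a‖ ^ 2 + ‖b‖ ^ 2 = 1 := by
  rw [mem_sphere_zero_iff_norm, ← sq_eq_sq₀ (norm_nonneg _) zero_le_one,
    WithLp.prod_norm_sq_eq_of_L2]
  simp

/-- The map `z₁ + z₂ j ↦ w₁ z₁ + w₂ z₂ j` of the sphere. -/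
def rotFun (w₁ w₂ : Circle) (x : S3) : S3 :=
  ⟨WithLp.toLp 2 (w₁ * x.1.fst, w₂ * x.1.snd), by
    rw [mem_S3_iff]
    simpa [Circle.norm_coe] using (mem_S3_iff x.1.fst x.1.snd).1 x.2⟩

/-- The isometry `z₁ + z₂ j ↦ w₁ z₁ + w₂ z₂ j` of the sphere, for `|w₁| = |w₂| = 1`. -/
def rot (w₁ w₂ : Circle) : S3 ≃ᵢ S3 where
  toFun := rotFun w₁ w₂
  invFun := rotFun w₁⁻¹ w₂⁻¹
  left_inv x := by
    apply Subtype.ext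
    apply (WithLp.ofLp_injective 2)
    apply Prod.ext <;> simp [rotFun]
  right_inv x := by
    apply Subtype.ext
    apply (WithLp.ofLp_injective 2)
    apply Prod.ext <;> simp [rotFun]
  isometry_toFun := by
    refine Isometry.of_dist_eq fun x y => ?_
    rw [Subtype.dist_eq, Subtype.dist_eq, WithLp.prod_dist_eq_of_L2, WithLp.prod_dist_eq_of_L2]
    simp [rotFun, dist_eq_norm, ← mul_sub, Circle.norm_coe]

/-- The isometry `ρ` sending `z₁ + z₂ j` to `e^{2π i g/e} z₁ + e^{2π i d/e} z₂ j`. -/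
def rho (d e g : ℤ) : S3 ≃ᵢ S3 :=
  rot (Circle.exp (2 * Real.pi * ((g : ℝ) / (e : ℝ))))
    (Circle.exp (2 * Real.pi * ((d : ℝ) / (e : ℝ))))

/-- The solid torus `T₁ = {z₁ + z₂ j ∈ S³ : |z₁| ≤ √2 / 2}`. -/
def T1 : Set S3 := {x | ‖x.1.fst‖ ≤ √2 / 2}

/-- The boundary torus `{|z₁| = √2 / 2}` of `T₁`. -/
def T1Boundary : Set T1 := {x | ‖x.1.1.fst‖ = √2 / 2}

theorem norm_sqrt_two_div_two : ‖((√2 / 2 : ℝ) : ℂ)‖ = √2 / 2 := by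
  rw [Complex.norm_real, Real.norm_of_nonneg (by positivity)]

/-- The point `(√2 / 2) (z + w j)` of the boundary of `T₁`. -/
def torusPoint (z w : Circle) : T1Boundary :=
  ⟨⟨⟨WithLp.toLp 2 (((√2 / 2 : ℝ) : ℂ) * z, ((√2 / 2 : ℝ) : ℂ) * w), by
      rw [mem_S3_iff, norm_mul, norm_mul, norm_sqrt_two_div_two, Circle.norm_coe, Circle.norm_coe,
        mul_one, div_pow, Real.sq_sqrt (by norm_num)]
      norm_num⟩,
    le_of_eq (by
      change ‖((√2 / 2 : ℝ) : ℂ) * z‖ = √2 / 2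
      rw [norm_mul, norm_sqrt_two_div_two, Circle.norm_coe, mul_one])⟩, by
    change ‖((√2 / 2 : ℝ) : ℂ) * z‖ = √2 / 2
    rw [norm_mul, norm_sqrt_two_div_two, Circle.norm_coe, mul_one]⟩

theorem continuous_torusPoint : Continuous fun p : Circle × Circle => torusPoint p.1 p.2 := by
  refine Continuous.subtype_mk (Continuous.subtype_mk (Continuous.subtype_mk ?_ _) _) _
  refine (WithLp.prod_continuous_toLp 2 ℂ ℂ).comp ?_
  fun_prop

/-- The meridian `μ` of `T₁`: the curve `z ↦ (√2 / 2) (z + j)`. -/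
def mu : C(Circle, T1Boundary) where
  toFun z := torusPoint z 1
  continuous_toFun := continuous_torusPoint.comp (continuous_id.prodMk continuous_const)

/-- The longitude `λ` of `T₁`, a meridian of the complementary solid torus `|z₂| ≤ √2 / 2`:
the curve `z ↦ (√2 / 2) (1 + z j)`. -/
def lam : C(Circle, T1Boundary) where
  toFun z := torusPoint 1 z
  continuous_toFun := continuous_torusPoint.comp (continuous_const.prodMk continuous_id)

/-! ### The quotient `T₁ / ⟨ρ⟩` -/

/-- Two points of `T` are equivalent if some element of the group `G` of isometries of the sphere
sends the first to the second. -/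
def orbitSetoid (G : Subgroup (S3 ≃ᵢ S3)) (T : Set S3) : Setoid T where
  r x y := ∃ f ∈ G, f x = y
  iseqv :=
    { refl := fun _ => ⟨1, G.one_mem, rfl⟩
      symm := by
        rintro x y ⟨f, hf, h⟩
        exact ⟨f⁻¹, G.inv_mem hf, by rw [← h]; exact f.symm_apply_apply _⟩
      trans := by
        rintro x y z ⟨f, hf, h⟩ ⟨k, hk, h'⟩
        exact ⟨k * f, G.mul_mem hk hf, by rw [← h', ← h]; rfl⟩ }

/-- The quotient `T₁ / ⟨ρ⟩`, with the quotient topology. -/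
abbrev T1Quotient (d e g : ℤ) : Type :=
  Quotient (orbitSetoid (Subgroup.zpowers (rho d e g)) T1)

/-- The quotient map `π₁ : T₁ → T₁ / ⟨ρ⟩`. -/
def quotientMap (d e g : ℤ) : C(T1, T1Quotient d e g) where
  toFun := Quotient.mk _
  continuous_toFun := continuous_quotient_mk'

/-- The boundary of `T₁ / ⟨ρ⟩`, the image of the boundary of `T₁`. -/
def quotientBoundary (d e g : ℤ) : Set (T1Quotient d e g) := quotientMap d e g '' T1Boundary

/-- The map `∂T₁ → ∂(T₁ / ⟨ρ⟩)` that `π₁` restricts to. -/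
def boundaryMap (d e g : ℤ) : C(T1Boundary, quotientBoundary d e g) where
  toFun x := ⟨quotientMap d e g x.1, x.1, x.2, rfl⟩
  continuous_toFun := by fun_prop

end TorusQuotient

end

/-!
In the coordinates `(u, w) = (√2 z₁, z₂ / |z₂|)` the solid torus `T₁` is `D² × S¹`, the boundary
torus is `|u| = 1`, and `ρ` acts by `(u, w) ↦ (ζ ^ g u, ζ ^ d w)` with `ζ = e^{2πi/e}`. Write
`c = gcd(d, e)`, `d = c d'`, `e = c e'`. The monomials `u ^ c w ^ (-g d̄)` and `w ^ e'` are invariant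
under `ρ`, because `d' d̄ ≡ 1` modulo `e'`, and together they separate the orbits
(`monomialMap_eq_iff`): equality of the second monomial lets a power of `ρ` match the coordinates
`w`, and the powers of `ρ ^ e'`, which fix `w`, then move `u` through all `c`-th roots of unity
because `g` is prime to `c`. So `(u, w) ↦ (u ^ c w ^ (-g d̄), w ^ e')`, a continuous surjection of
`D² × S¹` onto itself, identifies the compact space `T₁ / ⟨ρ⟩` with `D² × S¹`, boundary going to
boundary (`exists_quotient_framing`). Let `μ'` and `λ'` be the images of `∂D² × {1}` and `{1} × S¹`
under this framing.

On the boundary `μ` and `λ` become `z ↦ (z ^ c, 1)` and `z ↦ (z ^ (-g d̄), z ^ e')`. It remains to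
see that `z ↦ (z ^ a, z ^ b)` has class `a [μ'] + b [λ']` on the torus (`curveClass_torusCurve`).
Only additivity of homology classes is needed, not a computation of `H₁`: in a topological monoid
the pointwise product of two based loops is homologous to their sum, by a single singular
`2`-simplex (`curveClass_mul`).
-/

namespace TorusQuotient

/-! ### One-dimensional homology classes of loops -/

section LoopClass

universe w v u

variable {C : Type u} [Category.{v} C] [Limits.HasCoproducts.{w} C] [Preadditive C]
  (R : C)

theorem loop_comp_d {S : SSet.{w}} {s : S _⦋1⦌} (h : S.δ 0 s = S.δ 1 s) :
    S.ιChainComplex (R := R) s ≫ (S.chainComplex R).d 1 0 = 0 := by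
  rw [SSet.ιChainComplex_d, Fin.sum_univ_two, h]
  simp

variable [CategoryWithHomology C]

/-- The homology class of a `1`-simplex whose two faces agree, as a morphism out of the
coefficient object. -/
noncomputable def loopClass {S : SSet.{w}} {s : S _⦋1⦌} (h : S.δ 0 s = S.δ 1 s) :
    R ⟶ S.homology R 1 :=
  (S.chainComplex R).liftCycles (S.ιChainComplex s) 0 (by simp) (loop_comp_d R h) ≫
    (S.chainComplex R).homologyπ 1

/-- If all the edges of a `2`-simplex are loops, its boundary expresses the class of the long edge
as a sum. -/
theorem loopClass_add {S : SSet.{w}} (t : S _⦋2⦌) {s₀ s₁ s₂ : S _⦋1⦌} (e₀ : S.δ 0 t = s₀)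
    (e₁ : S.δ 1 t = s₁) (e₂ : S.δ 2 t = s₂) (h₀ : S.δ 0 s₀ = S.δ 1 s₀)
    (h₁ : S.δ 0 s₁ = S.δ 1 s₁) (h₂ : S.δ 0 s₂ = S.δ 1 s₂) :
    loopClass R h₁ = loopClass R h₂ + loopClass R h₀ := by
  subst e₀ e₁ e₂
  have key := (S.chainComplex R).liftCycles_homologyπ_eq_zero_of_boundary
    (S.ιChainComplex (S.δ 0 t) - S.ιChainComplex (S.δ 1 t) + S.ιChainComplex (S.δ 2 t)) 0
    (by simp) (S.ιChainComplex t) (by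
      rw [SSet.ιChainComplex_d, Fin.sum_univ_three]
      simp [sub_eq_add_neg])
  have split : (S.chainComplex R).liftCycles
      (S.ιChainComplex (S.δ 0 t) - S.ιChainComplex (S.δ 1 t) + S.ιChainComplex (S.δ 2 t)) 0
      (by simp) (by
        rw [Preadditive.add_comp, Preadditive.sub_comp, loop_comp_d R h₀, loop_comp_d R h₁,
          loop_comp_d R h₂]
        simp) =
      (S.chainComplex R).liftCycles (S.ιChainComplex (S.δ 0 t)) 0 (by simp) (loop_comp_d R h₀) -
      (S.chainComplex R).liftCycles (S.ιChainComplex (S.δ 1 t)) 0 (by simp) (loop_comp_d R h₁) +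
      (S.chainComplex R).liftCycles (S.ιChainComplex (S.δ 2 t)) 0 (by simp)
        (loop_comp_d R h₂) := by
    rw [← cancel_mono ((S.chainComplex R).iCycles 1)]
    simp [Preadditive.add_comp, Preadditive.sub_comp]
  rw [split, Preadditive.add_comp, Preadditive.sub_comp] at key
  change loopClass R h₀ - loopClass R h₁ + loopClass R h₂ = 0 at key
  rw [← sub_eq_zero, ← neg_eq_zero, ← key]
  abel

theorem loopClass_comp_homologyMap {S T : SSet.{w}} (f : S ⟶ T) {s : S _⦋1⦌}
    (h : S.δ 0 s = S.δ 1 s) (h' : T.δ 0 (f.app _ s) = T.δ 1 (f.app _ s)) :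
    loopClass R h ≫ SSet.homologyMap f R 1 = loopClass R h' := by
  simp [loopClass, SSet.homologyMap]

end LoopClass

/-! ### Classes of closed curves -/

variable {X Y Z : Type} [TopologicalSpace X] [TopologicalSpace Y] [TopologicalSpace Z]

theorem H1.map_comp_apply (g : C(Y, Z)) (f : C(X, Y)) (a : H1 X) :
    H1.map g (H1.map f a) = H1.map (g.comp f) a := by
  unfold H1.map
  rw [TopCat.ofHom_comp, Functor.map_comp]
  rfl

theorem H1.map_curveClass (f : C(X, Y)) (γ : C(Circle, X)) :
    H1.map f (curveClass γ) = curveClass (f.comp γ) :=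
  H1.map_comp_apply f γ _

/-- A continuous map on a standard simplex, as a singular simplex. -/
noncomputable def singularSimplex {n : ℕ} (f : C(stdSimplex ℝ (Fin (n + 1)), X)) :
    (TopCat.toSSet.obj (TopCat.of X)) _⦋n⦌ :=
  (TopCat.toSSetObjEquiv (TopCat.of X) (Opposite.op ⦋n⦌)).symm f

/-- The inclusion of the `i`-th face of a standard simplex. -/
noncomputable def faceInclusion {n : ℕ} (i : Fin (n + 2)) :
    C(stdSimplex ℝ (Fin (n + 1)), stdSimplex ℝ (Fin (n + 2))) :=
  ⟨stdSimplex.map i.succAbove, stdSimplex.continuous_map _⟩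

theorem δ_singularSimplex {n : ℕ} (f : C(stdSimplex ℝ (Fin (n + 2)), X)) (i : Fin (n + 2)) :
    (TopCat.toSSet.obj (TopCat.of X)).δ i (singularSimplex f) =
      singularSimplex (f.comp (faceInclusion i)) :=
  rfl

theorem singularSimplex_faces {f : C(stdSimplex ℝ (Fin 2), X)}
    (h : f (stdSimplex.vertex 1) = f (stdSimplex.vertex 0)) :
    (TopCat.toSSet.obj (TopCat.of X)).δ 0 (singularSimplex f) =
      (TopCat.toSSet.obj (TopCat.of X)).δ 1 (singularSimplex f) := by
  rw [δ_singularSimplex, δ_singularSimplex]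
  congr 1
  ext x
  rw [Subsingleton.elim x (stdSimplex.vertex 0)]
  change f (stdSimplex.map _ _) = f (stdSimplex.map _ _)
  rw [stdSimplex.map_vertex, stdSimplex.map_vertex]
  simpa using h

theorem circleLoop_vertex (i : Fin 2) : circleLoop (stdSimplex.vertex i) = 1 := by
  fin_cases i <;> simp [circleLoop]

theorem curve_circleLoop_closed (γ : C(Circle, X)) :
    (γ.comp circleLoop) (stdSimplex.vertex 1) = (γ.comp circleLoop) (stdSimplex.vertex 0) := by
  simp [circleLoop_vertex]

/-- The class of a closed curve is represented by the curve itself, as a singular cycle. -/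
theorem curveClass_eq_loopClass (γ : C(Circle, X)) :
    curveClass γ = (loopClass (ModuleCat.of ℤ ℤ)
      (singularSimplex_faces (curve_circleLoop_closed γ))).hom (1 : ℤ) := by
  have := loopClass_comp_homologyMap (ModuleCat.of ℤ ℤ) (TopCat.toSSet.map (TopCat.ofHom γ))
    (s := circleSimplex) circleSimplex_faces
    (singularSimplex_faces (curve_circleLoop_closed γ))
  exact congr($(this).hom (1 : ℤ))

/-! ### Products of loops in a topological group -/

variable {G : Type} [TopologicalSpace G]

theorem faceInclusion_apply {n : ℕ} (i : Fin (n + 2)) (x : stdSimplex ℝ (Fin (n + 1)))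
    (j : Fin (n + 2)) :
    (faceInclusion i x).1 j = ∑ k with i.succAbove k = j, x.1 k := by
  change (stdSimplex.map i.succAbove x : _ → ℝ) j = _
  rw [stdSimplex.map_coe, FunOnFinite.linearMap_apply_apply]
  rfl

/-- The pointwise product of two based loops is homologous to their sum: the product is the
diagonal of the square `(s, t) ↦ γ₁ s * γ₂ t`, and half of that square is a singular `2`-simplex
whose other two edges are `γ₁` and `γ₂`. -/
theorem curveClass_mul [Monoid G] [ContinuousMul G] (γ₁ γ₂ : C(Circle, G)) (h₁ : γ₁ 1 = 1)
    (h₂ : γ₂ 1 = 1) : curveClass (γ₁ * γ₂) = curveClass γ₁ + curveClass γ₂ := by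
  -- The affine coordinates `x₁ + x₂` and `x₂` map the simplex onto the triangle `t ≤ s`.
  let τ : C(stdSimplex ℝ (Fin 3), G) :=
    { toFun x := γ₁ (Circle.exp (2 * Real.pi * (x.1 1 + x.1 2))) *
        γ₂ (Circle.exp (2 * Real.pi * x.1 2))
      continuous_toFun := by
        have (i : Fin 3) : Continuous fun x : stdSimplex ℝ (Fin 3) => x.1 i :=
          (continuous_apply i).comp continuous_subtype_val
        exact (γ₁.continuous.comp (Circle.exp.continuous.comp
            (continuous_const.mul ((this 1).add (this 2))))).mul
          (γ₂.continuous.comp (Circle.exp.continuous.comp (continuous_const.mul (this 2)))) }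
  rw [curveClass_eq_loopClass, curveClass_eq_loopClass, curveClass_eq_loopClass]
  refine congr($(loopClass_add (ModuleCat.of ℤ ℤ) (singularSimplex τ) ?_ ?_ ?_ _ _ _).hom (1 : ℤ))
  all_goals
    rw [δ_singularSimplex]
    congr 1
    ext x
    have hx := x.2.2
    rw [Fin.sum_univ_two] at hx
    simp [τ, circleLoop, faceInclusion_apply, Finset.sum_filter, Fin.sum_univ_two,
      Fin.succAbove, Fin.lt_def, hx, h₁, h₂]

/-- The class of a closed one-parameter subgroup, as a homomorphism. -/
noncomputable def curveClassHom [CommGroup G] [IsTopologicalGroup G] :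
    Additive (Circle →ₜ* G) →+ H1 G :=
  AddMonoidHom.mk' (fun φ => curveClass φ.toMul.toContinuousMap) fun φ ψ =>
    curveClass_mul φ.toMul.toContinuousMap ψ.toMul.toContinuousMap (map_one φ.toMul)
      (map_one ψ.toMul)

/-- The curve `z ↦ (z ^ a, z ^ b)` on the torus. -/
noncomputable def torusCurve (a b : ℤ) : Circle →ₜ* Circle × Circle where
  toFun z := (z ^ a, z ^ b)
  map_one' := by simp
  map_mul' x y := by simp [mul_zpow]
  continuous_toFun := (continuous_zpow a).prodMk (continuous_zpow b)

theorem curveClass_torusCurve (a b : ℤ) :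
    curveClass (torusCurve a b).toContinuousMap =
      a • curveClass (torusCurve 1 0).toContinuousMap +
        b • curveClass (torusCurve 0 1).toContinuousMap := by
  have add (p q : ℤ × ℤ) : torusCurve (p + q).1 (p + q).2 =
      torusCurve p.1 p.2 * torusCurve q.1 q.2 :=
    ContinuousMonoidHom.ext fun z => Prod.ext (zpow_add z _ _) (zpow_add z _ _)
  -- `F (a, b)` is the class of `torusCurve a b`, so the claim is additivity of `F`.
  let F : ℤ × ℤ →+ H1 (Circle × Circle) :=
    curveClassHom.comp (AddMonoidHom.mk' (fun p => Additive.ofMul (torusCurve p.1 p.2)) add)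
  have key : F (a • (1, 0) + b • (0, 1)) = a • F (1, 0) + b • F (0, 1) := by
    rw [map_add, map_zsmul, map_zsmul]
  have hab : a • ((1, 0) : ℤ × ℤ) + b • ((0, 1) : ℤ × ℤ) = (a, b) := by simp
  rw [hab] at key
  exact key

/-! ### Roots of unity on the circle -/

/-- The number `e^{2πi/e}` on the unit circle. -/
noncomputable def rootOfUnity (e : ℤ) : Circle := Circle.exp (2 * Real.pi / e)

theorem rootOfUnity_zpow (e n : ℤ) :
    rootOfUnity e ^ n = Circle.exp (2 * Real.pi * ((n : ℝ) / (e : ℝ))) := by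
  rw [rootOfUnity, ← Circle.exp_intCast_mul]
  congr 1
  ring

theorem rootOfUnity_zpow_eq_one {e n : ℤ} (he : e ≠ 0) (h : e ∣ n) : rootOfUnity e ^ n = 1 := by
  obtain ⟨k, rfl⟩ := h
  have : (e : ℝ) ≠ 0 := by exact_mod_cast he
  rw [rootOfUnity_zpow, Int.cast_mul, mul_div_cancel_left₀ _ this, Circle.exp_two_pi_mul_int]

theorem rootOfUnity_zpow_eq_zpow {e m n : ℤ} (he : e ≠ 0) (h : e ∣ m - n) :
    rootOfUnity e ^ m = rootOfUnity e ^ n := by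
  rw [← div_eq_one, div_eq_mul_inv, ← zpow_sub, rootOfUnity_zpow_eq_one he h]

/-- The solutions of `w ^ b = 1` are powers of the `a`-th power of `e^{2πi/(ab)}`. -/
theorem exists_rootOfUnity_zpow {a b : ℤ} (ha : a ≠ 0) (hb : b ≠ 0) {w : Circle}
    (hw : w ^ b = 1) : ∃ k : ℤ, w = rootOfUnity (a * b) ^ (a * k) := by
  obtain ⟨t, rfl⟩ := Circle.exp_surjective w
  rw [← Circle.exp_intCast_mul, Circle.exp_eq_one] at hw
  obtain ⟨k, hk⟩ := hw
  have ha' : (a : ℝ) ≠ 0 := by exact_mod_cast ha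
  have hb' : (b : ℝ) ≠ 0 := by exact_mod_cast hb
  refine ⟨k, ?_⟩
  rw [rootOfUnity_zpow]
  congr 1
  push_cast
  field_simp
  linarith

theorem exists_circle_zpow_eq {n : ℤ} (hn : n ≠ 0) (v : Circle) : ∃ w : Circle, w ^ n = v := by
  obtain ⟨t, rfl⟩ := Circle.exp_surjective v
  have hn' : (n : ℝ) ≠ 0 := by exact_mod_cast hn
  refine ⟨Circle.exp (t / n), ?_⟩
  rw [← Circle.exp_intCast_mul]
  congr 1
  field_simp

/-! ### The quotient of the standard solid torus by a cyclic group of rotations -/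

/-- The rotation `(u, w) ↦ (α u, β w)` of the standard solid torus. -/
noncomputable def stdRot (α β : Circle) (p : StdSolidTorus) : StdSolidTorus :=
  (⟨α * p.1, by
    simpa [Circle.norm_coe, -Subtype.coe_prop] using mem_closedBall_zero_iff.1 p.1.2⟩, β * p.2)

/-- The self-map `(u, w) ↦ (u ^ c w ^ a, w ^ b)` of the standard solid torus. -/
noncomputable def monomialMap (c : ℕ) (a b : ℤ) (p : StdSolidTorus) : StdSolidTorus :=
  (⟨(p.1 : ℂ) ^ c * (p.2 ^ a : Circle), by
    have := mem_closedBall_zero_iff.1 p.1.2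
    simpa [Circle.norm_coe] using pow_le_one₀ (norm_nonneg _) this⟩, p.2 ^ b)

theorem continuous_monomialMap (c : ℕ) (a b : ℤ) : Continuous (monomialMap c a b) := by
  refine Continuous.prodMk (Continuous.subtype_mk (Continuous.mul ?_ ?_) _) ?_
  · fun_prop
  · exact continuous_subtype_val.comp
      ((continuous_zpow (G := Circle) a).comp continuous_snd)
  · exact (continuous_zpow b).comp continuous_snd

theorem monomialMap_surjective {c : ℕ} (a : ℤ) {b : ℤ} (hc : c ≠ 0) (hb : b ≠ 0) :
    Function.Surjective (monomialMap c a b) := by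
  rintro ⟨u, v⟩
  obtain ⟨w, rfl⟩ := exists_circle_zpow_eq hb v
  obtain ⟨z, hz⟩ := IsAlgClosed.exists_pow_nat_eq ((u : ℂ) * ((w ^ a)⁻¹ : Circle))
    (Nat.pos_of_ne_zero hc)
  have hz1 : ‖z‖ ≤ 1 := by
    rw [← pow_le_one_iff_of_nonneg (norm_nonneg z) hc, ← norm_pow, hz]
    simpa [Circle.norm_coe] using mem_closedBall_zero_iff.1 u.2
  refine ⟨(⟨z, by simpa using hz1⟩, w), Prod.ext (Subtype.ext ?_) rfl⟩
  change z ^ c * (w ^ a : Circle) = u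
  rw [hz, mul_assoc, ← Circle.coe_mul, inv_mul_cancel, Circle.coe_one, mul_one]

theorem norm_monomialMap_fst (c : ℕ) (a b : ℤ) (p : StdSolidTorus) :
    ‖((monomialMap c a b p).1 : ℂ)‖ = ‖(p.1 : ℂ)‖ ^ c := by
  simp [monomialMap, Circle.norm_coe]

theorem monomialMap_mem_stdBoundary {c : ℕ} (hc : c ≠ 0) (a b : ℤ) (p : StdSolidTorus) :
    monomialMap c a b p ∈ stdBoundary ↔ p ∈ stdBoundary := by
  change ‖((monomialMap c a b p).1 : ℂ)‖ = 1 ↔ ‖(p.1 : ℂ)‖ = 1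
  rw [norm_monomialMap_fst, pow_eq_one_iff_of_nonneg (norm_nonneg _) hc]

theorem exists_unit_mul_of_pow_eq {c : ℕ} (hc : c ≠ 0) {u v : ℂ} (h : v ^ c = u ^ c) :
    ∃ η : Circle, η ^ c = 1 ∧ v = η * u := by
  by_cases hu : u = 0
  · subst hu
    exact ⟨1, one_pow _, by simpa [hc] using h⟩
  have h1 : (v / u) ^ c = 1 := by rw [div_pow, h, div_self (pow_ne_zero _ hu)]
  refine ⟨⟨v / u, mem_sphere_zero_iff_norm.2 (Complex.norm_eq_one_of_pow_eq_one h1 hc)⟩, ?_, ?_⟩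
  · exact Circle.ext h1
  · exact (div_mul_cancel₀ v hu).symm

/-- With `ζ = e^{2πi/(cb)}`, the fibres of `(u, w) ↦ (u ^ c w ^ (-g d̄), w ^ b)` are the orbits
of the rotation `(u, w) ↦ (ζ ^ g u, ζ ^ (cd) w)`. -/
theorem monomialMap_eq_iff {c : ℕ} {d b g dbar : ℤ} (hc : c ≠ 0) (hb : b ≠ 0)
    (hcg : IsCoprime g (c : ℤ)) (hd : b ∣ 1 - d * dbar) (p q : StdSolidTorus) :
    monomialMap c (-(g * dbar)) b p = monomialMap c (-(g * dbar)) b q ↔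
      ∃ k : ℤ,
        stdRot (rootOfUnity (c * b) ^ (g * k)) (rootOfUnity (c * b) ^ (c * d * k)) p = q := by
  have hc' : (c : ℤ) ≠ 0 := by exact_mod_cast hc
  have hcb : (c * b : ℤ) ≠ 0 := mul_ne_zero hc' hb
  have invariant (k : ℤ) : monomialMap c (-(g * dbar)) b
      (stdRot (rootOfUnity (c * b) ^ (g * k)) (rootOfUnity (c * b) ^ (c * d * k)) p) =
        monomialMap c (-(g * dbar)) b p := by
    refine Prod.ext (Subtype.ext ?_) ?_
    · have : (rootOfUnity (c * b) ^ (g * k)) ^ c *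
          (rootOfUnity (c * b) ^ (c * d * k)) ^ (-(g * dbar)) = 1 := by
        rw [← zpow_natCast, ← zpow_mul, ← zpow_mul, ← zpow_add]
        apply rootOfUnity_zpow_eq_one hcb
        obtain ⟨m, hm⟩ := hd
        exact ⟨g * k * m, by linear_combination (c * g * k) * hm⟩
      have h2 : ((rootOfUnity (c * b) ^ (g * k) : Circle) : ℂ) ^ c *
          ((rootOfUnity (c * b) ^ (c * d * k) : Circle) ^ (-(g * dbar)) : Circle) = 1 := by
        exact_mod_cast congrArg (Circle.coeHom) this
      change (((rootOfUnity (c * b) ^ (g * k) : Circle) : ℂ) * p.1) ^ c *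
        (((rootOfUnity (c * b) ^ (c * d * k)) * p.2) ^ (-(g * dbar)) : Circle) =
          (p.1 : ℂ) ^ c * (p.2 ^ (-(g * dbar)) : Circle)
      rw [mul_pow, mul_zpow, Circle.coe_mul]
      linear_combination ((p.1 : ℂ) ^ c * (p.2 ^ (-(g * dbar)) : Circle)) * h2
    · change (_ * p.2) ^ b = p.2 ^ b
      rw [mul_zpow, ← zpow_mul, rootOfUnity_zpow_eq_one hcb ⟨d * k, by ring⟩, one_mul]
  refine ⟨fun h => ?_, ?_⟩
  · -- First match the second coordinates by a power of the rotation.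
    obtain ⟨m, hm⟩ : ∃ m : ℤ, q.2 / p.2 = rootOfUnity (c * b) ^ (c * m) := by
      apply exists_rootOfUnity_zpow hc' hb
      rw [div_zpow, div_eq_one]
      exact (congrArg Prod.snd h).symm
    have hq : q.2 = rootOfUnity (c * b) ^ (c * d * (dbar * m)) * p.2 := by
      rw [← div_eq_iff_eq_mul, hm]
      apply rootOfUnity_zpow_eq_zpow hcb
      obtain ⟨l, hl⟩ := hd
      exact ⟨l * m, by linear_combination (c * m) * hl⟩
    -- The first coordinates then differ by a `c`-th root of unity.
    have h3 := (congrArg (fun x => (x.1 : ℂ)) ((invariant (dbar * m)).trans h))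
    change (((rootOfUnity (c * b) ^ (g * (dbar * m)) : Circle) : ℂ) * p.1) ^ c *
        (((rootOfUnity (c * b) ^ (c * d * (dbar * m))) * p.2) ^ (-(g * dbar)) : Circle) =
          (q.1 : ℂ) ^ c * (q.2 ^ (-(g * dbar)) : Circle) at h3
    rw [← hq] at h3
    obtain ⟨η, hη, hη'⟩ :=
      exists_unit_mul_of_pow_eq hc (mul_right_cancel₀ (Circle.coe_ne_zero _) h3).symm
    obtain ⟨n, hn⟩ := exists_rootOfUnity_zpow (a := b) (b := c) hb hc' (w := η)
      (by exact_mod_cast hη)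
    obtain ⟨x, y, hxy⟩ := hcg
    -- The power `b * x * n` of the rotation fixes `w` and multiplies `u` by `η`.
    refine ⟨dbar * m + b * x * n, Prod.ext (Subtype.ext ?_) ?_⟩
    · change ((rootOfUnity (c * b) ^ (g * (dbar * m + b * x * n)) : Circle) : ℂ) * p.1 = q.1
      have : rootOfUnity (c * b) ^ (g * (b * x * n)) = η := by
        rw [hn, mul_comm b (c : ℤ)]
        apply rootOfUnity_zpow_eq_zpow hcb
        exact ⟨-(y * n), by linear_combination (b * n) * hxy⟩
      rw [mul_add, zpow_add, this, hη', Circle.coe_mul]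
      ring
    · change rootOfUnity (c * b) ^ (c * d * (dbar * m + b * x * n)) * p.2 = q.2
      rw [hq, rootOfUnity_zpow_eq_zpow hcb]
      exact ⟨d * x * n, by ring⟩
  · rintro ⟨k, rfl⟩
    exact (invariant k).symm

/-! ### Coordinates on `T₁` -/

theorem norm_snd_sq (x : T1) : ‖x.1.1.snd‖ ^ 2 = 1 - ‖x.1.1.fst‖ ^ 2 := by
  linarith [(mem_S3_iff x.1.1.fst x.1.1.snd).1 x.1.2]

theorem snd_ne_zero (x : T1) : x.1.1.snd ≠ 0 := by
  intro h
  have h1 := norm_snd_sq x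
  have h2 : ‖x.1.1.fst‖ ^ 2 ≤ (√2 / 2) ^ 2 := pow_le_pow_left₀ (norm_nonneg _) x.2 2
  rw [div_pow, Real.sq_sqrt zero_le_two] at h2
  rw [h, norm_zero] at h1
  linarith

theorem norm_sqrt_two_mul (z : ℂ) : ‖((√2 : ℝ) : ℂ) * z‖ = √2 * ‖z‖ := by
  rw [norm_mul, Complex.norm_real, Real.norm_of_nonneg (Real.sqrt_nonneg 2)]

theorem sqrt_two_mul_half : √2 * (√2 / 2) = 1 := by
  rw [← mul_div_assoc, Real.mul_self_sqrt zero_le_two, div_self two_ne_zero]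

/-- The coordinates `z₁ + z₂ j ↦ (√2 z₁, z₂ / |z₂|)`, identifying `T₁` with `D² × S¹`. -/
noncomputable def coords (x : T1) : StdSolidTorus :=
  (⟨((√2 : ℝ) : ℂ) * x.1.1.fst, by
    rw [mem_closedBall_zero_iff, norm_sqrt_two_mul]
    exact (mul_le_mul_of_nonneg_left x.2 (Real.sqrt_nonneg 2)).trans_eq sqrt_two_mul_half⟩,
  ⟨x.1.1.snd / ‖x.1.1.snd‖, mem_sphere_zero_iff_norm.2 (by
    rw [norm_div, Complex.norm_real, norm_norm, div_self (norm_ne_zero_iff.2 (snd_ne_zero x))])⟩)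

theorem continuous_coords : Continuous coords := by
  have h : Continuous fun x : T1 => x.1.1.ofLp :=
    (WithLp.prod_continuous_ofLp 2 ℂ ℂ).comp (continuous_subtype_val.comp continuous_subtype_val)
  have h1 : Continuous fun x : T1 => x.1.1.fst := continuous_fst.comp h
  have h2 : Continuous fun x : T1 => x.1.1.snd := continuous_snd.comp h
  refine Continuous.prodMk (Continuous.subtype_mk (continuous_const.mul h1) _)
    (Continuous.subtype_mk (h2.div (Complex.continuous_ofReal.comp h2.norm) fun x => ?_) _)
  exact Complex.ofReal_ne_zero.2 (norm_ne_zero_iff.2 (snd_ne_zero x))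

theorem coords_injective : Function.Injective coords := by
  intro x y h
  have h1 : x.1.1.fst = y.1.1.fst := by
    have : ((√2 : ℝ) : ℂ) * x.1.1.fst = ((√2 : ℝ) : ℂ) * y.1.1.fst :=
      congrArg (fun p => (p.1 : ℂ)) h
    exact mul_left_cancel₀ (by simp) this
  have hn : ‖x.1.1.snd‖ = ‖y.1.1.snd‖ := by
    rw [← sq_eq_sq₀ (norm_nonneg _) (norm_nonneg _), norm_snd_sq, norm_snd_sq, h1]
  have h2 : x.1.1.snd = y.1.1.snd := by
    have : x.1.1.snd / ‖x.1.1.snd‖ = y.1.1.snd / ‖y.1.1.snd‖ := congrArg (fun p => (p.2 : ℂ)) h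
    rw [hn] at this
    exact (div_left_inj' (by simpa using snd_ne_zero y)).1 this
  exact Subtype.ext (Subtype.ext (WithLp.ofLp_injective 2 (Prod.ext h1 h2)))

theorem coords_surjective : Function.Surjective coords := by
  rintro ⟨⟨u, hu⟩, w⟩
  have hu1 : ‖u‖ ≤ 1 := mem_closedBall_zero_iff.1 hu
  have hu2 : ‖u‖ ^ 2 ≤ 1 := pow_le_one₀ (norm_nonneg u) hu1
  have hpos : 0 < 1 - ‖u‖ ^ 2 / 2 := by linarith
  have hn1 : ‖((√2 / 2 : ℝ) : ℂ) * u‖ = √2 / 2 * ‖u‖ := by rw [norm_mul, norm_sqrt_two_div_two]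
  have hn2 : ‖((√(1 - ‖u‖ ^ 2 / 2) : ℝ) : ℂ) * w‖ = √(1 - ‖u‖ ^ 2 / 2) := by
    rw [norm_mul, Circle.norm_coe, mul_one, Complex.norm_real,
      Real.norm_of_nonneg (Real.sqrt_nonneg _)]
  refine ⟨⟨⟨WithLp.toLp 2 (((√2 / 2 : ℝ) : ℂ) * u, ((√(1 - ‖u‖ ^ 2 / 2) : ℝ) : ℂ) * w), ?_⟩, ?_⟩,
    Prod.ext (Subtype.ext ?_) (Circle.ext ?_)⟩
  · rw [mem_S3_iff, hn1, hn2, Real.sq_sqrt hpos.le, mul_pow, div_pow, Real.sq_sqrt zero_le_two]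
    ring
  · change ‖((√2 / 2 : ℝ) : ℂ) * u‖ ≤ √2 / 2
    rw [hn1]
    exact mul_le_of_le_one_right (by positivity) hu1
  · change ((√2 : ℝ) : ℂ) * (((√2 / 2 : ℝ) : ℂ) * u) = u
    rw [← mul_assoc, ← Complex.ofReal_mul, sqrt_two_mul_half, Complex.ofReal_one, one_mul]
  · change ((√(1 - ‖u‖ ^ 2 / 2) : ℝ) : ℂ) * w / ‖((√(1 - ‖u‖ ^ 2 / 2) : ℝ) : ℂ) * w‖ = w
    rw [hn2]
    exact mul_div_cancel_left₀ _ (by exact_mod_cast (Real.sqrt_pos.2 hpos).ne')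

theorem coords_mem_stdBoundary (x : T1) : coords x ∈ stdBoundary ↔ x ∈ T1Boundary := by
  change ‖((√2 : ℝ) : ℂ) * x.1.1.fst‖ = 1 ↔ ‖x.1.1.fst‖ = √2 / 2
  rw [norm_sqrt_two_mul, ← mul_right_inj' (c := √2 / 2) (a := √2) (by simp), sqrt_two_mul_half]

theorem coords_torusPoint (z w : Circle) : coords (torusPoint z w).1 = (rim z, w) := by
  refine Prod.ext (Subtype.ext ?_) (Circle.ext ?_)
  · change ((√2 : ℝ) : ℂ) * (((√2 / 2 : ℝ) : ℂ) * z) = z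
    rw [← mul_assoc, ← Complex.ofReal_mul, sqrt_two_mul_half, Complex.ofReal_one, one_mul]
  · change ((√2 / 2 : ℝ) : ℂ) * w / ‖((√2 / 2 : ℝ) : ℂ) * w‖ = w
    rw [norm_mul, norm_sqrt_two_div_two, Circle.norm_coe, mul_one]
    exact mul_div_cancel_left₀ _ (by simp)

/-- In coordinates the rotations of `T₁` are the rotations of the standard solid torus. -/
theorem coords_eq_stdRot_iff (α β : Circle) (x y : T1) :
    stdRot α β (coords x) = coords y ↔ rot α β x.1 = y.1 := by
  have hT : rotFun α β x.1 ∈ T1 := by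
    change ‖(α : ℂ) * x.1.1.fst‖ ≤ √2 / 2
    rw [norm_mul, Circle.norm_coe, one_mul]
    exact x.2
  have h : coords ⟨rotFun α β x.1, hT⟩ = stdRot α β (coords x) := by
    refine Prod.ext (Subtype.ext ?_) (Circle.ext ?_)
    · exact mul_left_comm _ _ _
    · change (β : ℂ) * x.1.1.snd / ‖(β : ℂ) * x.1.1.snd‖ = β * (x.1.1.snd / ‖x.1.1.snd‖)
      rw [norm_mul, Circle.norm_coe, one_mul, mul_div_assoc]
  rw [← h, coords_injective.eq_iff, Subtype.ext_iff]
  rfl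

/-- `rot` as a homomorphism from the torus to the isometry group of the sphere. -/
noncomputable def rotHom : Circle × Circle →* (S3 ≃ᵢ S3) where
  toFun p := rot p.1 p.2
  map_one' := by
    ext x : 1
    apply Subtype.ext
    apply WithLp.ofLp_injective 2
    apply Prod.ext <;> simp [rot, rotFun]
  map_mul' p q := by
    ext x : 1
    apply Subtype.ext
    apply WithLp.ofLp_injective 2
    apply Prod.ext <;> simp [rot, rotFun, mul_assoc]

theorem rho_zpow (d e g k : ℤ) :
    rho d e g ^ k = rot (rootOfUnity e ^ (g * k)) (rootOfUnity e ^ (d * k)) := by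
  rw [zpow_mul, zpow_mul, rootOfUnity_zpow, rootOfUnity_zpow]
  exact (map_zpow rotHom (_, _) k).symm

theorem orbitSetoid_rho_iff (d e g : ℤ) (x y : T1) :
    orbitSetoid (Subgroup.zpowers (rho d e g)) T1 x y ↔
      ∃ k : ℤ, stdRot (rootOfUnity e ^ (g * k)) (rootOfUnity e ^ (d * k)) (coords x) =
        coords y := by
  change (∃ f ∈ Subgroup.zpowers (rho d e g), f x.1 = y.1) ↔ _
  simp only [Subgroup.mem_zpowers_iff, exists_exists_eq_and, rho_zpow, coords_eq_stdRot_iff]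

/-! ### The framing of the quotient -/

instance compactSpace_T1 : CompactSpace T1 := by
  refine isCompact_iff_compactSpace.1 (IsClosed.isCompact ?_)
  refine isClosed_le ?_ continuous_const
  exact (continuous_fst.comp
    ((WithLp.prod_continuous_ofLp 2 ℂ ℂ).comp continuous_subtype_val)).norm

/-- The invariant monomials frame the quotient: `monomialMap`, read in the coordinates on `T₁`,
becomes the quotient map after a homeomorphism carrying boundary to boundary. -/
theorem exists_quotient_framing {c : ℕ} {d b g dbar : ℤ} (hc : c ≠ 0) (hb : b ≠ 0)
    (hcg : IsCoprime g (c : ℤ)) (hd : b ∣ 1 - d * dbar) :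
    ∃ h : StdSolidTorus ≃ₜ T1Quotient (c * d) (c * b) g,
      IsFraming (quotientBoundary (c * d) (c * b) g) h ∧
      ∀ x, h (monomialMap c (-(g * dbar)) b (coords x)) =
        quotientMap (c * d) (c * b) g x := by
  have fibre (x y : T1) : monomialMap c (-(g * dbar)) b (coords x) =
      monomialMap c (-(g * dbar)) b (coords y) ↔
        orbitSetoid (Subgroup.zpowers (rho (c * d) (c * b) g)) T1 x y := by
    rw [monomialMap_eq_iff hc hb hcg hd, orbitSetoid_rho_iff]
  let F : T1Quotient (c * d) (c * b) g → StdSolidTorus :=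
    Quotient.lift (fun x => monomialMap c (-(g * dbar)) b (coords x)) fun x y hxy =>
      (fibre x y).2 hxy
  have hF : Continuous F :=
    ((continuous_monomialMap _ _ _).comp continuous_coords).quotient_lift _
  have hbij : Function.Bijective F := by
    constructor
    · rintro ⟨x⟩ ⟨y⟩ hxy
      exact Quotient.sound ((fibre x y).1 hxy)
    · intro p
      obtain ⟨q, rfl⟩ := monomialMap_surjective (-(g * dbar)) hc hb p
      obtain ⟨x, rfl⟩ := coords_surjective q
      exact ⟨quotientMap _ _ _ x, rfl⟩
  let H : T1Quotient (c * d) (c * b) g ≃ₜ StdSolidTorus :=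
    Continuous.homeoOfEquivCompactToT2 (f := Equiv.ofBijective F hbij) hF
  have hH (x : T1) : H (quotientMap _ _ _ x) = monomialMap c (-(g * dbar)) b (coords x) := rfl
  refine ⟨H.symm, ?_, fun x => ?_⟩
  -- Membership in either boundary is read off from `‖u‖ = 1`, which `monomialMap` respects.
  · rw [IsFraming, H.symm.image_eq_preimage_symm, H.symm_symm]
    ext y
    obtain ⟨x, rfl⟩ : ∃ x, quotientMap _ _ _ x = y := Quotient.exists_rep y
    rw [Set.mem_preimage, hH, monomialMap_mem_stdBoundary hc, coords_mem_stdBoundary]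
    refine ⟨fun hx => ⟨x, hx, rfl⟩, ?_⟩
    rintro ⟨x', hx', hxx'⟩
    rw [← coords_mem_stdBoundary, ← monomialMap_mem_stdBoundary hc (-(g * dbar)) b] at hx' ⊢
    rwa [← hH, ← hxx', hH]
  · rw [← hH, H.symm_apply_apply]

/-- The torus `S¹ × S¹`, embedded as the boundary of a framed solid torus. -/
noncomputable def framedTorus {V : Type} [TopologicalSpace V] {B : Set V} {h : StdSolidTorus ≃ₜ V}
    (hB : IsFraming B h) : C(Circle × Circle, B) where
  toFun p := ⟨h (rim p.1, p.2), hB ▸ Set.mem_image_of_mem h (Circle.norm_coe p.1)⟩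
  continuous_toFun := by
    refine Continuous.subtype_mk (h.continuous.comp (Continuous.prodMk ?_ continuous_snd)) _
    exact Continuous.subtype_mk (continuous_subtype_val.comp continuous_fst) _

theorem monomialMap_rim (c : ℕ) (a b : ℤ) (z w : Circle) :
    monomialMap c a b (rim z, w) = (rim (z ^ c * w ^ a), w ^ b) :=
  Prod.ext (Subtype.ext (by simp [monomialMap, rim])) rfl

/-- On the boundary the quotient map is `(z, w) ↦ (z ^ c w ^ (-g d̄), w ^ b)`, which determines the
images of the classes of `μ` and `λ`. -/
theorem exists_meridian_longitude {c : ℕ} {d b g dbar : ℤ} (hc : c ≠ 0) (hb : b ≠ 0)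
    (hcg : IsCoprime g (c : ℤ)) (hd : b ∣ 1 - d * dbar) :
    ∃ m l : C(Circle, quotientBoundary (c * d) (c * b) g),
      IsMeridianLongitudePair (quotientBoundary (c * d) (c * b) g) m l ∧
      H1.map (boundaryMap (c * d) (c * b) g) (curveClass mu) = (c : ℤ) • curveClass m ∧
      H1.map (boundaryMap (c * d) (c * b) g) (curveClass lam) =
        (-(g * dbar)) • curveClass m + b • curveClass l := by
  obtain ⟨h, hB, hh⟩ := exists_quotient_framing (c := c) (d := d) (b := b) hc hb hcg hd
  let ι := framedTorus hB
  have image_torusPoint (z w : Circle) : boundaryMap (c * d) (c * b) g (torusPoint z w) =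
      ι (z ^ c * w ^ (-(g * dbar)), w ^ b) := by
    apply Subtype.ext
    change quotientMap _ _ _ (torusPoint z w).1 = h (rim _, _)
    rw [← hh, coords_torusPoint, monomialMap_rim]
  have class_torusCurve (a a' : ℤ) : curveClass (ι.comp (torusCurve a a').toContinuousMap) =
      a • curveClass (ι.comp (torusCurve 1 0).toContinuousMap) +
        a' • curveClass (ι.comp (torusCurve 0 1).toContinuousMap) := by
    simp only [← H1.map_curveClass]
    rw [curveClass_torusCurve, map_add, map_zsmul, map_zsmul]
  refine ⟨ι.comp (torusCurve 1 0).toContinuousMap, ι.comp (torusCurve 0 1).toContinuousMap,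
    ⟨h, hB, fun z => ?_, fun z => ?_⟩, ?_, ?_⟩
  · change h (rim (z ^ (1 : ℤ)), z ^ (0 : ℤ)) = _
    rw [zpow_one, zpow_zero]
  · change h (rim (z ^ (0 : ℤ)), z ^ (1 : ℤ)) = _
    rw [zpow_one, zpow_zero]
  · have : (boundaryMap (c * d) (c * b) g).comp mu = ι.comp (torusCurve c 0).toContinuousMap := by
      ext z : 1
      refine (image_torusPoint z 1).trans ?_
      change _ = ι (z ^ (c : ℤ), z ^ (0 : ℤ))
      simp
    rw [H1.map_curveClass, this, class_torusCurve, zero_smul, add_zero]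
  · have : (boundaryMap (c * d) (c * b) g).comp lam =
        ι.comp (torusCurve (-(g * dbar)) b).toContinuousMap := by
      ext z : 1
      refine (image_torusPoint 1 z).trans ?_
      change _ = ι (z ^ (-(g * dbar)), z ^ b)
      simp
    rw [H1.map_curveClass, this, class_torusCurve]

end TorusQuotient

theorem mainTheorem4 (d e g : ℤ) (he : e ≠ 0) (hgcd : Int.gcd (Int.gcd d e) g = 1) :
    TorusQuotient.IsSolidTorus (TorusQuotient.T1Quotient d e g)
        (TorusQuotient.quotientBoundary d e g) ∧
      ∀ dbar : ℤ, (d / (Int.gcd d e : ℤ)) * dbar ≡ 1 [ZMOD e / (Int.gcd d e : ℤ)] →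
        ∃ mu' lam' : C(Circle, TorusQuotient.quotientBoundary d e g),
          TorusQuotient.IsMeridianLongitudePair (TorusQuotient.quotientBoundary d e g) mu' lam' ∧
          TorusQuotient.H1.map (TorusQuotient.boundaryMap d e g)
              (TorusQuotient.curveClass TorusQuotient.mu) =
            (Int.gcd d e : ℤ) • TorusQuotient.curveClass mu' ∧
          TorusQuotient.H1.map (TorusQuotient.boundaryMap d e g)
              (TorusQuotient.curveClass TorusQuotient.lam) =
            (-(g * dbar)) • TorusQuotient.curveClass mu' +
              (e / (Int.gcd d e : ℤ)) • TorusQuotient.curveClass lam' := by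
  have hc : Int.gcd d e ≠ 0 := by simp [Int.gcd_eq_zero_iff, he]
  have hcg : IsCoprime g (Int.gcd d e : ℤ) := (Int.isCoprime_iff_gcd_eq_one.2 hgcd).symm
  have hcop : IsCoprime (d / (Int.gcd d e : ℤ)) (e / (Int.gcd d e : ℤ)) :=
    Int.isCoprime_iff_gcd_eq_one.2 (Int.gcd_div_gcd_div_gcd (Nat.pos_of_ne_zero hc))
  have hd : d = (Int.gcd d e : ℤ) * (d / (Int.gcd d e : ℤ)) :=
    (Int.mul_ediv_cancel' (Int.gcd_dvd_left d e)).symm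
  have he' : e = (Int.gcd d e : ℤ) * (e / (Int.gcd d e : ℤ)) :=
    (Int.mul_ediv_cancel' (Int.gcd_dvd_right d e)).symm
  -- Eliminate `d` and `e` in favour of the common divisor `c` and the quotients `d'`, `e'`.
  generalize Int.gcd d e = c at *
  generalize d / (c : ℤ) = d' at *
  generalize e / (c : ℤ) = e' at *
  subst hd he'
  have hb : e' ≠ 0 := right_ne_zero_of_mul he
  constructor
  · obtain ⟨x, y, hxy⟩ := hcop
    obtain ⟨h, hB, -⟩ := TorusQuotient.exists_quotient_framing (d := d') (dbar := x) hc hb hcg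
      ⟨y, by linear_combination -hxy⟩
    exact ⟨h, hB⟩
  · intro dbar hdbar
    exact TorusQuotient.exists_meridian_longitude hc hb hcg hdbar.dvd
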